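/- Let $F$ be a number field with ring of integers $\mathcal{O}_F$, let $S$ be a (possibly infinite) set of places of $F$ containing all infinite places, and let $\mathcal{O}_S=\{x\in F\mid x\in\mathcal{O}_v\text{ for all }v\notin S\}$ be the ring of $S$-integers. Finite places are identified with maximal ideals of $\mathcal{O}_F$. A locally compact $\mathcal{O}_S$-module is an $\mathcal{O}_S$-module with a locally compact Hausdorff group topology such that multiplication by each $\alpha\in\mathcal{O}_S$ is continuous; morphisms are continuous $\mathcal{O}_S$-linear maps. A vector module is such a module whose underlying topological group is isomorphic to some $\mathbb{R}^n$. The module $X$ is vector-free if $X\simeq V\oplus X'$ with $V$ a vector module forces $V=0$. It is adelic if $X\simeq V\oplus Q$ with $V$ a vector module and $Q=\{\alpha c\mid\alpha\in\mathcal{O}_S,\ c\in C\}$ for some compact clopen $\mathcal{O}_F$-submodule $C\subseteq Q$ with $\bigcap_{\alpha\in\mathcal{O}_S^\times}\alpha C=0$. For a finite place $P$ let $$A^P=\{a\in A\mid \text{for every neighbourhood } U \text{ of } 0 \text{ there is } N\ge 1 \text{ with } P^N\cdot a\subseteq U\}.$$ Theorem. Let $A$ be a vector-free adelic locally compact $\mathcal{O}_S$-module.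 1. $A$ is topologically torsion, i.e. every open neighbourhood of zero contains a compact clopen subgroup $W$ such that $A/W$ is discrete and torsion. 2. Both $A$ and its Pontryagin dual $A^\vee$ are totally disconnected. 3. For every finite place $P\in S$, $A^P$ is a closed $\mathcal{O}_S$-submodule of $A$. 4. There exist compact clopen $\mathcal{O}_F$-submodules $C\subseteq A$ with $$\bigcap_{\alpha\in\mathcal{O}_S^\times}\alpha C=0\quad\text{and}\quad\bigcup_{\alpha\in\mathcal{O}_S^\times}\alpha C=A,$$ and for every such $C$ there is an isomorphism of topological $\mathcal{O}_S$-modules $$A\simeq{\prod_{P\in S\text{ finite}}}'\,(A^P:A^P\cap C)$$ onto the restricted product with its restricted product topology (with $\mathcal{O}_S$ acting componentwise). Furthermore, for each finite place $P\in S$, $A^P\cap C$ is a compact clopen $\mathcal{O}_F$-submodule of $A^P$ with $\bigcap_{\alpha\in\mathcal{O}_S^\times}\alpha(A^P\cap C)=0$ and $\bigcup_{\alpha\in\mathcal{O}_S^\times}\alpha(A^P\cap C)=A^P$. 5. For each finite place $P\in S$, with $(p)=P\cap\mathbb{Z}$, $A^P$ is algebraically and topologically a finite-dimensional $\mathbb{Q}_p$-vector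 space: it has a $\mathbb{Q}_p$-vector space structure, extending its group structure, for which it is isomorphic to some $\mathbb{Q}_p^n$ by a linear homeomorphism. -/

import Mathlib

open IsDedekindDomain NumberField Topology Filter
open scoped Pointwise RestrictedProduct

universe u v

/-- An object of `LCA_{O_S}`: a module over the ring of `S`-integers `O_S` of the number field `F`
with a locally compact Hausdorff topology that makes it a topological group and for which
multiplication by each `α ∈ O_S` is continuous.

`S` is the set of *finite* places; the infinite places always belong to the ambient set of places
and do not influence `O_S = {x ∈ F | x ∈ O_v for all finite v ∉ S}`. -/
structure LCAMod (F : Type v) [Field F] [NumberField F] (S : Set (HeightOneSpectrum (𝓞 F))) where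
  carrier : Type u
  [addCommGroup : AddCommGroup carrier]
  [module : Module (S.integer F) carrier]
  [topologicalSpace : TopologicalSpace carrier]
  [isTopologicalAddGroup : IsTopologicalAddGroup carrier]
  [locallyCompactSpace : LocallyCompactSpace carrier]
  [t2Space : T2Space carrier]
  [continuousConstSMul : ContinuousConstSMul (S.integer F) carrier]

namespace LCAMod

variable {F : Type v} [Field F] [NumberField F] {S : Set (HeightOneSpectrum (𝓞 F))}

instance : CoeSort (LCAMod.{u, v} F S) (Type u) := ⟨LCAMod.carrier⟩

attribute [instance] addCommGroup module topologicalSpace isTopologicalAddGroup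
  locallyCompactSpace t2Space continuousConstSMul

/-- The `O_F`-module structure obtained by restricting scalars along `O_F → O_S`. -/
noncomputable instance instModuleRingOfIntegers (X : LCAMod.{u, v} F S) : Module (𝓞 F) X :=
  Module.compHom X (algebraMap (𝓞 F) (S.integer F))

instance instIsScalarTower (X : LCAMod.{u, v} F S) : IsScalarTower (𝓞 F) (S.integer F) X where
  smul_assoc r α x := by
    rw [Algebra.smul_def, mul_smul]
    rfl

/-- A vector module: the underlying topological group is isomorphic to some `ℝⁿ`. -/
def IsVectorModule (X : LCAMod.{u, v} F S) : Prop :=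
  ∃ n : ℕ, Nonempty (X ≃ₜ+ (Fin n → ℝ))

/-- Vector-free: every vector module that is a direct summand (algebraically and topologically)
is zero. -/
def IsVectorFree (X : LCAMod.{u, v} F S) : Prop :=
  ∀ V X' : LCAMod.{u, v} F S, V.IsVectorModule →
    Nonempty (X ≃L[S.integer F] (V × X')) → Subsingleton V

/-- Adelic: `X ≃ V ⊕ Q` with `V` a vector module and `Q = O_S · C` for a compact clopen
`O_F`-submodule `C` of `Q` with `⋂_{α ∈ O_Sˣ} α C = 0`. -/
def IsAdelic (X : LCAMod.{u, v} F S) : Prop :=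
  ∃ V Q : LCAMod.{u, v} F S, V.IsVectorModule ∧ Nonempty (X ≃L[S.integer F] (V × Q)) ∧
    ∃ C : Submodule (𝓞 F) Q, IsCompact (C : Set Q) ∧ IsClopen (C : Set Q) ∧
      {q : Q | ∃ α : S.integer F, ∃ c ∈ C, q = α • c} = Set.univ ∧
      ⋂ α : (S.integer F)ˣ, α • (C : Set Q) = {0}

/-- Topological torsion: every open neighbourhood of zero contains a compact clopen subgroup `W`
such that the quotient by `W` is discrete and torsion. -/
def IsTopologicalTorsion (X : LCAMod.{u, v} F S) : Prop :=
  ∀ U : Set X, IsOpen U → (0 : X) ∈ U →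
    ∃ W : AddSubgroup X, (W : Set X) ⊆ U ∧ IsCompact (W : Set X) ∧ IsClopen (W : Set X) ∧
      DiscreteTopology (X ⧸ W) ∧ IsAddTorsion (X ⧸ W)

/-- `a` is topological `P`-torsion: every neighbourhood of zero contains `P ^ N • a` for some
`N ≥ 1`. -/
def IsTopologicalPTorsion (X : LCAMod.{u, v} F S) (P : HeightOneSpectrum (𝓞 F)) (a : X) : Prop :=
  ∀ U ∈ 𝓝 (0 : X), ∃ N : ℕ, 1 ≤ N ∧ ∀ r ∈ P.asIdeal ^ N, r • a ∈ U

/-- `X^P`, the set of all topological `P`-torsion elements of `X`. It is an `O_S`-submodule. -/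
def topPTorsion (X : LCAMod.{u, v} F S) (P : HeightOneSpectrum (𝓞 F)) :
    Submodule (S.integer F) X where
  carrier := {a | X.IsTopologicalPTorsion P a}
  zero_mem' U hU := ⟨1, le_rfl, fun r _ => by simpa using mem_of_mem_nhds hU⟩
  add_mem' := by
    intro a b ha hb U hU
    have h : ∀ᶠ q : X × X in 𝓝 (0 : X) ×ˢ 𝓝 (0 : X), q.1 + q.2 ∈ U := by
      rw [← nhds_prod_eq]
      exact continuous_add.continuousAt.eventually (by simpa using hU)
    obtain ⟨U₁, hU₁, U₂, hU₂, h⟩ := Filter.mem_prod_iff.1 h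
    obtain ⟨N₁, hN₁, h₁⟩ := ha U₁ hU₁
    obtain ⟨N₂, hN₂, h₂⟩ := hb U₂ hU₂
    refine ⟨max N₁ N₂, le_max_of_le_left hN₁, fun r hr => ?_⟩
    rw [smul_add]
    exact @h (r • a, r • b) ⟨h₁ r (Ideal.pow_le_pow_right (le_max_left _ _) hr),
      h₂ r (Ideal.pow_le_pow_right (le_max_right _ _) hr)⟩
  smul_mem' := by
    intro α a ha U hU
    have h : (fun x : X => α • x) ⁻¹' U ∈ 𝓝 (0 : X) :=
      (continuous_const_smul α).continuousAt.preimage_mem_nhds (by simpa using hU)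
    obtain ⟨N, hN, h⟩ := ha _ h
    refine ⟨N, hN, fun r hr => ?_⟩
    have := h r hr
    rwa [Set.mem_preimage, ← algebraMap_smul (S.integer F) r a, smul_smul, mul_comm, ← smul_smul,
      algebraMap_smul] at this

/-- `X^P ∩ C` as an `O_F`-submodule of `X^P`. -/
noncomputable def topPTorsionInter (X : LCAMod.{u, v} F S) (C : Submodule (𝓞 F) X)
    (P : HeightOneSpectrum (𝓞 F)) : Submodule (𝓞 F) (X.topPTorsion P) :=
  C.comap ((X.topPTorsion P).subtype.restrictScalars (𝓞 F))

/-- A compact clopen `O_F`-submodule `C` of a topological `O_S`-module `M` such that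
`⋂_{α ∈ O_Sˣ} α C = 0` and `⋃_{α ∈ O_Sˣ} α C = M`. -/
structure IsAdelicLattice (S : Set (HeightOneSpectrum (𝓞 F))) {M : Type u} [AddCommGroup M]
    [TopologicalSpace M] [Module (𝓞 F) M] [Module (S.integer F) M]
    (C : Submodule (𝓞 F) M) : Prop where
  isCompact : IsCompact (C : Set M)
  isClopen : IsClopen (C : Set M)
  iInter_eq : ⋂ α : (S.integer F)ˣ, α • (C : Set M) = {0}
  iUnion_eq : ⋃ α : (S.integer F)ˣ, α • (C : Set M) = Set.univ

end LCAMod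

/-!
Since the vector part of a vector-free adelic module `A` vanishes, `A` contains a compact open
`𝓞 F`-submodule `C` such that the `S`-unit multiples of `C` cover `A` and intersect in `0`. By
finiteness of the class group, `S`-integers have denominators in the monoid of integral `S`-units
`u`, so that the submodules `u • C` are directed and, by compactness, form a basis of neighbourhoods
of `0` (`IsAdelicLattice.exists_smul_subset`). This gives topological torsion and total
disconnectedness; the dual is totally disconnected because `A` is a union of compact open
subgroups `u⁻¹ • C`, whose duals are discrete. Moreover `A ^ P` is closed, as the intersection over
`u` of the open subgroups of elements that are `P`-power torsion modulo `u • C`.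

For the restricted product decomposition, summation of components is a well-defined continuous
homomorphism from the restricted product to `A` (`IsAdelicLattice.sumHom`), since `A` is
complete and nonarchimedean and `A ^ P ∩ C ⊆ u • C` for every integral `S`-unit `u` prime to `P`. It
is injective because infinite sums of elements of the `A ^ Q`, `Q ≠ P`, are, modulo every `u • C`,
torsion prime to `P`. The image of the compact group `∏ (A ^ P ∩ C)` is closed, and it is dense in
`C`: a `P`-primary element of `C` modulo `u • C` lifts to `A ^ P ∩ C` by compactness
(`IsAdelicLattice.exists_sub_mem_of_pow_smul_mem`), and the ideal of multipliers taking a given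
element of `C` into `∑ (A ^ P ∩ C) + u • C` lies in no maximal ideal. Hence summation maps
`∏ (A ^ P ∩ C)` homeomorphically onto `C`, and is itself a topological isomorphism.

Finally, nonzero integers act on `A ^ P` by homeomorphisms, as some power of each is the product of
an integral `S`-unit and an integer prime to `P`. So `A ^ P` is a rational vector space; the action
of `ℚ` is continuous for the `p`-adic topology, hence extends to `ℚ_p` by completeness, and a
locally compact vector space over `ℚ_p` is finite-dimensional.
-/

/-! ### Integral `S`-units -/

namespace LCAMod

section Arithmetic

variable {F : Type v} [Field F] [NumberField F]

/-- The algebraic integers that are units of the ring of `S`-integers. -/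
noncomputable def integralSUnits (S : Set (HeightOneSpectrum (𝓞 F))) : Submonoid (𝓞 F) :=
  (IsUnit.submonoid (S.integer F)).comap (algebraMap (𝓞 F) (S.integer F))

variable {S : Set (HeightOneSpectrum (𝓞 F))}

theorem mem_integralSUnits {u : 𝓞 F} :
    u ∈ integralSUnits S ↔ IsUnit (algebraMap (𝓞 F) (S.integer F) u) := Iff.rfl

theorem ne_zero_of_mem_integralSUnits {u : 𝓞 F} (hu : u ∈ integralSUnits S) : u ≠ 0 := by
  rintro rfl
  rw [mem_integralSUnits, map_zero] at hu
  exact not_isUnit_zero hu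

theorem notMem_of_mem_integralSUnits {u : 𝓞 F} (hu : u ∈ integralSUnits S)
    {P : HeightOneSpectrum (𝓞 F)} (hP : P ∉ S) : u ∉ P.asIdeal := by
  obtain ⟨b, hb⟩ := (mem_integralSUnits.1 hu).exists_right_inv
  have hb' : algebraMap (𝓞 F) F u * (b : F) = 1 := congrArg Subtype.val hb
  rw [← HeightOneSpectrum.valuation_eq_one_iff_notMem (K := F)]
  have h1 := congrArg (P.valuation F) hb'
  rw [map_mul, map_one] at h1
  exact eq_one_of_one_le_mul_left (P.valuation_le_one u) (b.2 P hP) h1.ge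

theorem mem_integralSUnits_of_forall_notMem {u : 𝓞 F} (h0 : u ≠ 0)
    (h : ∀ P : HeightOneSpectrum (𝓞 F), P ∉ S → u ∉ P.asIdeal) : u ∈ integralSUnits S := by
  have h0' : algebraMap (𝓞 F) F u ≠ 0 := by simpa using h0
  refine mem_integralSUnits.2 (IsUnit.of_mul_eq_one ⟨(algebraMap (𝓞 F) F u)⁻¹, fun P hP => ?_⟩
    (Subtype.ext (mul_inv_cancel₀ h0')))
  rw [map_inv₀, (HeightOneSpectrum.valuation_eq_one_iff_notMem (K := F) P).2 (h P hP), inv_one]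

theorem mem_integralSUnits_of_mul_mem {u w : 𝓞 F} (h : u * w ∈ integralSUnits S) :
    w ∈ integralSUnits S := by
  rw [mem_integralSUnits, map_mul] at h
  exact isUnit_of_mul_isUnit_right h

variable (F) in
/-- Finiteness of the class group: a fixed power of every ideal is principal. -/
theorem exists_pow_eq_span_singleton :
    ∃ h : ℕ, h ≠ 0 ∧ ∀ I : Ideal (𝓞 F), ∃ x, I ^ h = Ideal.span {x} := by
  refine ⟨Fintype.card (ClassGroup (𝓞 F)), Fintype.card_ne_zero, fun I => ?_⟩
  by_cases hI : I = ⊥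
  · exact ⟨0, by
      rw [hI, ← Ideal.zero_eq_bot, zero_pow Fintype.card_ne_zero, Ideal.span_singleton_zero,
        Ideal.zero_eq_bot]⟩
  · have hI' : I ∈ nonZeroDivisors (Ideal (𝓞 F)) := mem_nonZeroDivisors_of_ne_zero hI
    have h1 : ClassGroup.mk0 (⟨I, hI'⟩ ^ Fintype.card (ClassGroup (𝓞 F))) = 1 := by
      rw [map_pow, pow_card_eq_one]
    rw [ClassGroup.mk0_eq_one_iff] at h1
    obtain ⟨x, hx⟩ := h1
    exact ⟨x, by simpa using hx⟩

theorem mem_integralSUnits_of_pow_eq_span {P : HeightOneSpectrum (𝓞 F)} (hP : P ∈ S) {h : ℕ}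
    {x : 𝓞 F} (hx : P.asIdeal ^ h = Ideal.span {x}) :
    x ∈ integralSUnits S := by
  refine mem_integralSUnits_of_forall_notMem ?_ fun Q hQ hxQ => ?_
  · rintro rfl
    rw [Ideal.span_singleton_zero] at hx
    exact pow_ne_zero h P.ne_bot hx
  · have h1 : P.asIdeal ^ h ≤ Q.asIdeal := by
      rwa [hx, Ideal.span_singleton_le_iff_mem]
    have h2 := P.isMaximal.eq_of_le Q.isPrime.ne_top (Ideal.IsPrime.le_of_pow_le h1)
    exact hQ (HeightOneSpectrum.ext h2 ▸ hP)

/-- If `P ^ h` is generated by `x`, then the `h`-th power of a nonzero algebraic integer is the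
product of a power of `x` and an integer prime to `P`. -/
theorem exists_pow_eq_pow_mul_notMem {P : HeightOneSpectrum (𝓞 F)} {h : ℕ}
    {x : 𝓞 F} (hx : P.asIdeal ^ h = Ideal.span {x}) {r : 𝓞 F} (hr : r ≠ 0) :
    ∃ (m : ℕ) (w : 𝓞 F), r ^ h = x ^ m * w ∧ w ∉ P.asIdeal := by
  have hv := P.intValuation_if_neg hr
  set m := (Associates.mk P.asIdeal).count (Associates.mk (Ideal.span {r})).factors
  have hv' : P.intValuation (r ^ h) = WithZero.exp (-((m * h : ℕ) : ℤ)) := by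
    rw [map_pow, hv, ← WithZero.exp_nsmul]
    congr 1
    push_cast
    simp [mul_comm]
  have hmem : r ^ h ∈ P.asIdeal ^ (h * m) := by
    rw [← HeightOneSpectrum.intValuation_le_pow_iff_mem, hv', mul_comm]
  rw [pow_mul, hx, Ideal.span_singleton_pow, Ideal.mem_span_singleton] at hmem
  obtain ⟨w, hw⟩ := hmem
  refine ⟨m, w, hw, fun hwP => ?_⟩
  have h2 : r ^ h ∈ P.asIdeal ^ (m * h + 1) := by
    rw [hw, pow_succ, mul_comm m h, pow_mul, hx, Ideal.span_singleton_pow]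
    exact Ideal.mul_mem_mul (Ideal.mem_span_singleton_self _) hwP
  rw [← HeightOneSpectrum.intValuation_le_pow_iff_mem, hv', WithZero.exp_le_exp] at h2
  push_cast at h2
  linarith

/-- Every `S`-integer has a denominator that is an `S`-unit: a generator of a power of its ideal of
denominators, which is divisible by primes in `S` only. -/
theorem exists_mem_integralSUnits_smul_eq (α : S.integer F) :
    ∃ u ∈ integralSUnits S, ∃ b : 𝓞 F,
      algebraMap (𝓞 F) (S.integer F) u * α = algebraMap (𝓞 F) (S.integer F) b := by
  obtain ⟨h, h0, hh⟩ := exists_pow_eq_span_singleton F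
  -- the ideal of denominators of `α`
  let I : Ideal (𝓞 F) := Submodule.comap (LinearMap.toSpanSingleton (𝓞 F) F (α : F))
    (LinearMap.range (Algebra.linearMap (𝓞 F) F))
  have hI : ∀ r : 𝓞 F, r ∈ I ↔ ∃ b : 𝓞 F, algebraMap (𝓞 F) F b = algebraMap (𝓞 F) F r * α := by
    intro r
    simp [I, Algebra.smul_def]
  obtain ⟨u, hu⟩ := hh I
  have huI : u ∈ I := Ideal.pow_le_self h0 (hu ▸ Ideal.mem_span_singleton_self u)
  refine ⟨u, mem_integralSUnits_of_forall_notMem ?_ fun P hP huP => ?_, ?_⟩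
  · rintro rfl
    rw [Ideal.span_singleton_zero] at hu
    have hI0 : I = ⊥ := eq_zero_of_pow_eq_zero hu
    obtain ⟨a, b, hb, hab⟩ := IsFractionRing.div_surjective (A := 𝓞 F) (α : F)
    have hbI : b ∈ I := (hI b).2 ⟨a, by
      have : algebraMap (𝓞 F) F b ≠ 0 := by
        simpa using nonZeroDivisors.ne_zero hb
      rw [← hab]; field_simp⟩
    rw [hI0, Ideal.mem_bot] at hbI
    exact nonZeroDivisors.ne_zero hb hbI
  · obtain ⟨n, s, hn⟩ := P.exists_primeCompl_mul_eq_of_integer (α : F) (α.2 P hP)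
    have hsI : (s : 𝓞 F) ∈ I := (hI s).2 ⟨n, by rw [mul_comm]; exact hn.symm⟩
    have h1 : I ^ h ≤ P.asIdeal := by rwa [hu, Ideal.span_singleton_le_iff_mem]
    exact s.2 (Ideal.IsPrime.le_of_pow_le h1 hsI)
  · obtain ⟨b, hb⟩ := (hI u).1 huI
    exact ⟨b, Subtype.ext hb.symm⟩

theorem exists_mem_pow_add_mul_eq_one {P : HeightOneSpectrum (𝓞 F)} {w : 𝓞 F}
    (hw : w ∉ P.asIdeal) (N : ℕ) : ∃ x ∈ P.asIdeal ^ N, ∃ y, x + y * w = 1 := by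
  have := P.isMaximal
  obtain ⟨y, x, hx, h⟩ := Ideal.IsMaximal.exists_inv_pow P.asIdeal hw N
  exact ⟨x, hx, y, by rw [add_comm]; exact h⟩

theorem eventually_notMem {u : 𝓞 F} (hu : u ≠ 0) :
    ∀ᶠ P : S in cofinite, u ∉ (P : HeightOneSpectrum (𝓞 F)).asIdeal := by
  have h : Set.Finite {P : HeightOneSpectrum (𝓞 F) | u ∈ P.asIdeal} := by
    have := Ideal.finite_factors (R := 𝓞 F) (I := Ideal.span {u})
      (by simpa [Ideal.span_singleton_eq_bot] using hu)
    refine this.subset fun P hP => ?_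
    exact (Ideal.dvd_span_singleton).2 hP
  have h2 := h.preimage (Subtype.val_injective (p := (· ∈ S))).injOn
  filter_upwards [h2.compl_mem_cofinite] with P hP using hP

end Arithmetic

end LCAMod

/-! ### Adelic lattices -/

namespace LCAMod

section Lattice

variable {F : Type v} [Field F] [NumberField F] {S : Set (HeightOneSpectrum (𝓞 F))}
  {A : LCAMod.{u, v} F S}

instance instContinuousConstSMulRingOfIntegers (X : LCAMod.{u, v} F S) :
    ContinuousConstSMul (𝓞 F) X :=
  ⟨fun r => continuous_const_smul (algebraMap (𝓞 F) (S.integer F) r)⟩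

/-- An integral `S`-unit acts on a module by a homeomorphism. -/
noncomputable def smulHomeomorph (A : LCAMod.{u, v} F S) {u : 𝓞 F} (hu : u ∈ integralSUnits S) :
    A ≃ₜ A :=
  Homeomorph.smul (mem_integralSUnits.1 hu).unit

theorem isOpen_smul {u : 𝓞 F} (hu : u ∈ integralSUnits S) {C : Submodule (𝓞 F) A}
    (hC : IsOpen (C : Set A)) : IsOpen ((u • C : Submodule (𝓞 F) A) : Set A) :=
  (A.smulHomeomorph hu).isOpenMap _ hC

theorem isCompact_smul (u : 𝓞 F) {C : Submodule (𝓞 F) A}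
    (hC : IsCompact (C : Set A)) : IsCompact ((u • C : Submodule (𝓞 F) A) : Set A) :=
  hC.image (continuous_const_smul u)

theorem smul_mem_smul_of_mul {u w : 𝓞 F} {C : Submodule (𝓞 F) A} {a : A} (h : a ∈ w • C) :
    u • a ∈ (u * w) • C := by
  rw [mul_smul]
  exact Submodule.smul_mem_pointwise_smul _ _ _ h

theorem mul_smul_le_left (u w : 𝓞 F) (C : Submodule (𝓞 F) A) : (u * w) • C ≤ u • C := by
  rw [mul_smul]
  rintro _ ⟨_, ⟨c, hc, rfl⟩, rfl⟩
  exact ⟨w • c, C.smul_mem w hc, rfl⟩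

theorem mul_smul_le_right (u w : 𝓞 F) (C : Submodule (𝓞 F) A) : (u * w) • C ≤ w • C := by
  rw [mul_comm]
  exact mul_smul_le_left w u C

theorem smul_le_self (u : 𝓞 F) (C : Submodule (𝓞 F) A) : u • C ≤ C := by
  rintro _ ⟨c, hc, rfl⟩
  exact C.smul_mem u hc

variable {C : Submodule (𝓞 F) A}

namespace IsAdelicLattice

theorem exists_smul_mem (hC : IsAdelicLattice S C) (a : A) :
    ∃ u ∈ integralSUnits S, u • a ∈ C := by
  have ha : a ∈ ⋃ α : (S.integer F)ˣ, α • (C : Set A) := hC.iUnion_eq ▸ Set.mem_univ a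
  obtain ⟨α, c, hc, rfl⟩ := Set.mem_iUnion.1 ha
  obtain ⟨u, hu, b, hb⟩ := exists_mem_integralSUnits_smul_eq (α : S.integer F)
  refine ⟨u, hu, ?_⟩
  have : u • α • c = b • c := by
    rw [← algebraMap_smul (S.integer F) u, ← algebraMap_smul (S.integer F) b, ← hb, mul_smul]
    rfl
  exact this ▸ C.smul_mem b hc

theorem eq_zero_of_forall_mem (hC : IsAdelicLattice S C) {a : A}
    (h : ∀ u ∈ integralSUnits S, a ∈ u • C) : a = 0 := by
  have : a ∈ ⋂ α : (S.integer F)ˣ, α • (C : Set A) := by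
    refine Set.mem_iInter.2 fun α => ?_
    obtain ⟨u, hu, b, hb⟩ := exists_mem_integralSUnits_smul_eq (α : S.integer F)
    have hb' : b ∈ integralSUnits S := by
      rw [mem_integralSUnits, ← hb]
      exact (mem_integralSUnits.1 hu).mul α.isUnit
    obtain ⟨c, hc, hca⟩ := h b hb'
    refine ⟨u • c, C.smul_mem u hc, ?_⟩
    have h1 : b • c = a := hca
    rw [← h1]
    change (α : S.integer F) • u • c = b • c
    rw [← algebraMap_smul (S.integer F) u, ← algebraMap_smul (S.integer F) b, ← hb, mul_comm,
      mul_smul]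
  rw [hC.iInter_eq] at this
  exact this

/-- The submodules `u • C`, for `u` an integral `S`-unit, are a basis of neighbourhoods of `0`:
they are compact, directed, and meet in `0`. -/
theorem exists_smul_subset (hC : IsAdelicLattice S C) {U : Set A} (hU : U ∈ 𝓝 (0 : A)) :
    ∃ u ∈ integralSUnits S, ((u • C : Submodule (𝓞 F) A) : Set A) ⊆ U := by
  have h := exists_subset_nhds_of_isCompact'
    (ι := integralSUnits S) (V := fun u => (((u : 𝓞 F) • C : Submodule (𝓞 F) A) : Set A))
    (U := U)
    (fun u w => ⟨u * w, mul_smul_le_left _ _ _, mul_smul_le_right _ _ _⟩)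
    (fun u => isCompact_smul _ hC.isCompact)
    (fun u => (isCompact_smul _ hC.isCompact).isClosed)
    (fun x hx => by
      rw [hC.eq_zero_of_forall_mem (a := x) fun u hu => Set.mem_iInter.1 hx ⟨u, hu⟩]
      exact hU)
  obtain ⟨u, hu⟩ := h
  exact ⟨u, u.2, hu⟩

theorem smul_mem_nhds_zero (hC : IsAdelicLattice S C) {u : 𝓞 F} (hu : u ∈ integralSUnits S) :
    ((u • C : Submodule (𝓞 F) A) : Set A) ∈ 𝓝 (0 : A) :=
  (isOpen_smul hu hC.isClopen.isOpen).mem_nhds (zero_mem _)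

/-- Some product `u * v` of integral `S`-units maps a given element into `u • C`, and it divides
a positive integer, its norm. -/
theorem isTopologicalTorsion (hC : IsAdelicLattice S C) : A.IsTopologicalTorsion := by
  intro U hU h0
  obtain ⟨u, hu, huU⟩ := hC.exists_smul_subset (hU.mem_nhds h0)
  have hopen := isOpen_smul hu hC.isClopen.isOpen
  have hcomp := isCompact_smul u hC.isCompact
  refine ⟨(u • C).toAddSubgroup, huU, hcomp, ⟨hcomp.isClosed, hopen⟩,
    QuotientAddGroup.discreteTopology hopen, ?_⟩
  intro x
  induction x using QuotientAddGroup.induction_on with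
  | H a =>
  obtain ⟨v, hv, hva⟩ := hC.exists_smul_mem a
  have huv : u * v ≠ 0 := ne_zero_of_mem_integralSUnits (mul_mem hu hv)
  -- a nonzero integer in the ideal `(u * v)`
  obtain ⟨n, hn, hdvd⟩ : ∃ n : ℕ, 0 < n ∧ u * v ∣ (n : 𝓞 F) := by
    refine ⟨Ideal.absNorm (Ideal.span {u * v}), ?_, ?_⟩
    · rw [Nat.pos_iff_ne_zero, Ne, Ideal.absNorm_eq_zero_iff]
      simpa [Ideal.span_singleton_eq_bot, -mul_eq_zero] using huv
    · exact Ideal.mem_span_singleton.1 (Ideal.absNorm_mem _)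
  obtain ⟨r, hr⟩ := hdvd
  refine isOfFinAddOrder_iff_nsmul_eq_zero.2 ⟨n, hn, ?_⟩
  rw [← QuotientAddGroup.mk_nsmul, QuotientAddGroup.eq_zero_iff]
  change n • a ∈ u • C
  rw [← Nat.cast_smul_eq_nsmul (𝓞 F), hr, mul_comm, mul_smul, mul_smul]
  exact Submodule.smul_mem _ _ (Submodule.smul_mem_pointwise_smul _ _ _ hva)

theorem totallyDisconnectedSpace (hC : IsAdelicLattice S C) : TotallyDisconnectedSpace A := by
  have : TotallySeparatedSpace A := by
    refine totallySeparatedSpace_iff_exists_isClopen.2 fun x y hxy => ?_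
    have hne : y - x ≠ 0 := sub_ne_zero.2 hxy.symm
    obtain ⟨u, hu, h⟩ : ∃ u ∈ integralSUnits S, y - x ∉ u • C := by
      by_contra! h
      exact hne (hC.eq_zero_of_forall_mem h)
    have hcl : IsClopen ((u • C : Submodule (𝓞 F) A) : Set A) :=
      ⟨(isCompact_smul u hC.isCompact).isClosed, isOpen_smul hu hC.isClopen.isOpen⟩
    refine ⟨(fun z => z - x) ⁻¹' (u • C : Submodule (𝓞 F) A),
      hcl.preimage (by fun_prop), ?_, h⟩
    rw [Set.mem_preimage, sub_self]
    exact zero_mem (u • C)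
  infer_instance

/-- Every point lies in a compact subgroup `u⁻¹ • C`, whose character group is discrete; hence
characters that differ at the point are separated by a clopen set. -/
theorem totallyDisconnectedSpace_dual (hC : IsAdelicLattice S C) :
    TotallyDisconnectedSpace (PontryaginDual (Multiplicative A)) := by
  have : TotallySeparatedSpace (PontryaginDual (Multiplicative A)) := by
    refine totallySeparatedSpace_iff_exists_isClopen.2 fun χ ψ hχψ => ?_
    obtain ⟨a, ha⟩ : ∃ a, χ a ≠ ψ a := by
      by_contra! h
      exact hχψ (PontryaginDual.ext h)
    obtain ⟨u, hu, hua⟩ := hC.exists_smul_mem a.toAdd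
    let K : Subgroup (Multiplicative A) := AddSubgroup.toSubgroup
      (C.toAddSubgroup.comap (DistribSMul.toAddMonoidHom A u))
    have hK : IsCompact (K : Set (Multiplicative A)) := by
      have : IsCompact ((A.smulHomeomorph hu) ⁻¹' (C : Set A)) :=
        (A.smulHomeomorph hu).isCompact_preimage.2 hC.isCompact
      exact this
    have := isCompact_iff_compactSpace.1 hK
    let f : K →ₜ* Multiplicative A := ⟨K.subtype, continuous_subtype_val⟩
    refine ⟨PontryaginDual.map f ⁻¹' {PontryaginDual.map f χ},
      (isClopen_discrete _).preimage (PontryaginDual.map f).continuous_toFun, rfl, fun h => ?_⟩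
    have h1 : PontryaginDual.map f ψ = PontryaginDual.map f χ := h
    exact ha (DFunLike.congr_fun h1 (⟨a, hua⟩ : K)).symm
  infer_instance

theorem mem_topPTorsion_iff (hC : IsAdelicLattice S C) {P : HeightOneSpectrum (𝓞 F)} {a : A} :
    a ∈ A.topPTorsion P ↔
      ∀ u ∈ integralSUnits S, ∃ N : ℕ, ∀ r ∈ P.asIdeal ^ N, r • a ∈ u • C := by
  constructor
  · intro ha u hu
    obtain ⟨N, -, h⟩ := ha _ (hC.smul_mem_nhds_zero hu)
    exact ⟨N, h⟩
  · intro h U hU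
    obtain ⟨u, hu, huU⟩ := hC.exists_smul_subset hU
    obtain ⟨N, hN⟩ := h u hu
    exact ⟨N + 1, by omega, fun r hr => huU (hN r (Ideal.pow_le_pow_right (by omega) hr))⟩

/-- `A ^ P` is an intersection of open, hence closed, subgroups. -/
theorem isClosed_topPTorsion (hC : IsAdelicLattice S C) (P : HeightOneSpectrum (𝓞 F)) :
    IsClosed (A.topPTorsion P : Set A) := by
  let H (u : 𝓞 F) : AddSubgroup A :=
    { carrier := {a | ∃ N : ℕ, ∀ r ∈ P.asIdeal ^ N, r • a ∈ u • C}
      zero_mem' := ⟨0, fun r _ => by simp⟩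
      add_mem' := by
        rintro a b ⟨N, hN⟩ ⟨M, hM⟩
        refine ⟨max N M, fun r hr => ?_⟩
        rw [smul_add]
        exact add_mem (hN r (Ideal.pow_le_pow_right (le_max_left _ _) hr))
          (hM r (Ideal.pow_le_pow_right (le_max_right _ _) hr))
      neg_mem' := by
        rintro a ⟨N, hN⟩
        exact ⟨N, fun r hr => by rw [smul_neg]; exact neg_mem (hN r hr)⟩ }
  have hH : (A.topPTorsion P : Set A) = ⋂ u ∈ integralSUnits S, (H u : Set A) := by
    ext a
    simp only [SetLike.mem_coe, hC.mem_topPTorsion_iff, Set.mem_iInter]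
    rfl
  rw [hH]
  refine isClosed_biInter fun u hu => AddSubgroup.isClosed_of_isOpen _ ?_
  exact AddSubgroup.isOpen_of_mem_nhds _ (g := 0) (mem_of_superset (hC.smul_mem_nhds_zero hu)
    fun a ha => ⟨0, fun r _ => Submodule.smul_mem _ _ ha⟩)

/-- The intersection of an adelic lattice with `A ^ P` is an adelic lattice of `A ^ P`. -/
theorem topPTorsionInter (hC : IsAdelicLattice S C) (P : HeightOneSpectrum (𝓞 F)) :
    IsAdelicLattice S (A.topPTorsionInter C P) where
  isCompact := (hC.isClosed_topPTorsion P).isClosedEmbedding_subtypeVal.isCompact_preimage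
    hC.isCompact
  isClopen := hC.isClopen.preimage continuous_subtype_val
  iInter_eq := by
    refine Set.eq_singleton_iff_unique_mem.2 ⟨Set.mem_iInter.2 fun α => ⟨0, zero_mem _, ?_⟩, ?_⟩
    · exact smul_zero α
    · intro x hx
      have : (x : A) ∈ ⋂ α : (S.integer F)ˣ, α • (C : Set A) := by
        refine Set.mem_iInter.2 fun α => ?_
        obtain ⟨c, hc, rfl⟩ := Set.mem_iInter.1 hx α
        exact ⟨c, hc, rfl⟩
      rw [hC.iInter_eq] at this
      exact Subtype.ext this
  iUnion_eq := by
    refine Set.eq_univ_of_forall fun x => ?_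
    have hx : (x : A) ∈ ⋃ α : (S.integer F)ˣ, α • (C : Set A) := hC.iUnion_eq ▸ Set.mem_univ _
    obtain ⟨α, c, hc, hcx⟩ := Set.mem_iUnion.1 hx
    refine Set.mem_iUnion.2 ⟨α, (α⁻¹ : (S.integer F)ˣ) • x, ?_, smul_inv_smul α x⟩
    change (α⁻¹ : (S.integer F)ˣ) • (x : A) ∈ C
    rw [← hcx]
    change α⁻¹ • α • c ∈ C
    rwa [inv_smul_smul]

end IsAdelicLattice

/-- A vector-free adelic module contains an adelic lattice: its vector part vanishes. -/
theorem IsAdelic.exists_isAdelicLattice (had : A.IsAdelic) (hvf : A.IsVectorFree) :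
    ∃ C : Submodule (𝓞 F) A, IsAdelicLattice S C := by
  obtain ⟨V, Q, hV, ⟨e⟩, C, hcomp, hclopen, huniv, hinter⟩ := had
  have := hvf V Q hV ⟨e⟩
  let f : A ≃L[S.integer F] Q :=
    { toFun a := (e a).2
      invFun q := e.symm (0, q)
      map_add' a b := by simp
      map_smul' α a := by simp
      left_inv a := by
        rw [ContinuousLinearEquiv.symm_apply_eq]
        exact Prod.ext (Subsingleton.elim _ _) rfl
      right_inv q := by simp
      continuous_toFun := continuous_snd.comp e.continuous
      continuous_invFun := e.symm.continuous.comp (by fun_prop) }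
  have hfR (r : 𝓞 F) (a : A) : f (r • a) = r • f a :=
    map_smul f (algebraMap (𝓞 F) (S.integer F) r) a
  let C' : Submodule (𝓞 F) A :=
    { carrier := f ⁻¹' C
      zero_mem' := by simp
      add_mem' := fun ha hb => by
        rw [Set.mem_preimage, map_add]
        exact add_mem ha hb
      smul_mem' := fun r a ha => by
        rw [Set.mem_preimage, hfR]
        exact C.smul_mem r ha }
  have hf (α : (S.integer F)ˣ) (a : A) : a ∈ α • (C' : Set A) ↔ f a ∈ α • (C : Set Q) := by
    rw [Set.mem_smul_set_iff_inv_smul_mem, Set.mem_smul_set_iff_inv_smul_mem]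
    change f (((α⁻¹ : (S.integer F)ˣ) : S.integer F) • a) ∈ C ↔ _
    rw [map_smul]
    rfl
  refine ⟨C', f.toHomeomorph.isCompact_preimage.2 hcomp, hclopen.preimage f.continuous, ?_, ?_⟩
  · ext a
    rw [Set.mem_iInter, Set.mem_singleton_iff]
    simp_rw [hf]
    rw [← Set.mem_iInter, hinter, Set.mem_singleton_iff, map_eq_zero_iff f f.injective]
  · refine Set.eq_univ_of_forall fun a => Set.mem_iUnion.2 ?_
    simp_rw [hf]
    obtain ⟨α, c, hc, h⟩ : f a ∈ {q : Q | ∃ α : S.integer F, ∃ c ∈ C, q = α • c} :=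
      huniv ▸ Set.mem_univ _
    obtain ⟨u, hu, b, hb⟩ := exists_mem_integralSUnits_smul_eq α
    refine ⟨(mem_integralSUnits.1 hu).unit⁻¹, ?_⟩
    rw [Set.mem_smul_set_iff_inv_smul_mem, inv_inv, h]
    change algebraMap (𝓞 F) (S.integer F) u • α • c ∈ C
    rw [smul_smul, hb, algebraMap_smul]
    exact C.smul_mem b hc

end Lattice

end LCAMod

/-! ### Decomposition into a restricted product -/

namespace LCAMod

section Decomposition

variable {F : Type v} [Field F] [NumberField F] {S : Set (HeightOneSpectrum (𝓞 F))}
  {A : LCAMod.{u, v} F S} {C : Submodule (𝓞 F) A}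

/-- The restricted product of the `A ^ P` with respect to the `A ^ P ∩ C`. -/
abbrev TorsionProduct (A : LCAMod.{u, v} F S) (C : Submodule (𝓞 F) A) : Type _ :=
  Πʳ P : S, [A.topPTorsion P, A.topPTorsionInter C P]

namespace IsAdelicLattice

/-- Division by integers prime to `P` is possible on `A ^ P` modulo each of the lattices `u • C`. -/
theorem mem_smul_of_smul_mem_smul (hC : IsAdelicLattice S C) {P : HeightOneSpectrum (𝓞 F)} {x : A}
    (hx : x ∈ A.topPTorsion P) {u w : 𝓞 F} (hu : u ∈ integralSUnits S) (hw : w ∉ P.asIdeal)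
    (h : w • x ∈ u • C) : x ∈ u • C := by
  obtain ⟨N, hN⟩ := hC.mem_topPTorsion_iff.1 hx u hu
  obtain ⟨r, hr, y, hry⟩ := exists_mem_pow_add_mul_eq_one hw N
  rw [← one_smul (𝓞 F) x, ← hry, add_smul, mul_smul]
  exact add_mem (hN r hr) (Submodule.smul_mem _ _ h)

theorem mem_smul_of_mem_topPTorsion (hC : IsAdelicLattice S C) {P : HeightOneSpectrum (𝓞 F)}
    {x : A} (hx : x ∈ A.topPTorsion P) (hxC : x ∈ C) {w : 𝓞 F} (hw : w ∈ integralSUnits S)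
    (hwP : w ∉ P.asIdeal) : x ∈ w • C :=
  hC.mem_smul_of_smul_mem_smul hx hw hwP (Submodule.smul_mem_pointwise_smul _ _ _ hxC)

theorem mem_topPTorsion_of_forall_mem_smul (hC : IsAdelicLattice S C)
    {P : HeightOneSpectrum (𝓞 F)} {z : A}
    (hz : ∀ w ∈ integralSUnits S, w ∉ P.asIdeal → z ∈ w • C) : z ∈ A.topPTorsion P := by
  refine hC.mem_topPTorsion_iff.2 fun v hv => ?_
  obtain ⟨h, h0, hh⟩ := exists_pow_eq_span_singleton F
  obtain ⟨x, hx⟩ := hh P.asIdeal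
  obtain ⟨m, w, hmw, hw⟩ := exists_pow_eq_pow_mul_notMem hx (ne_zero_of_mem_integralSUnits hv)
  have hwS : w ∈ integralSUnits S := mem_integralSUnits_of_mul_mem (hmw ▸ pow_mem hv h)
  refine ⟨h * m, fun r hr => ?_⟩
  rw [pow_mul, hx, Ideal.span_singleton_pow, Ideal.mem_span_singleton] at hr
  obtain ⟨s, rfl⟩ := hr
  rw [mul_comm, mul_smul]
  refine Submodule.smul_mem _ _ ?_
  have h1 : x ^ m • z ∈ (x ^ m * w) • C := smul_mem_smul_of_mul (hz w hwS hw)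
  rw [← hmw, ← Nat.sub_add_cancel (Nat.one_le_iff_ne_zero.2 h0), pow_succ] at h1
  exact mul_smul_le_right _ _ _ h1

/-- A `P`-primary element of `C` modulo `u • C` lifts to `A ^ P ∩ C`. The lift is found by
compactness in the intersection of all `w • C` with `w` prime to `P`. -/
theorem exists_sub_mem_of_pow_smul_mem (hC : IsAdelicLattice S C)
    {P : HeightOneSpectrum (𝓞 F)} {y : A} (hy : y ∈ C) {u : 𝓞 F}
    {m : ℕ} (hm : ∀ r ∈ P.asIdeal ^ m, r • y ∈ u • C) :
    ∃ z ∈ A.topPTorsion P, z ∈ C ∧ y - z ∈ u • C := by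
  let ι := {w : 𝓞 F // w ∈ integralSUnits S ∧ w ∉ P.asIdeal}
  have : Nonempty ι := ⟨1, one_mem _, fun h => P.isPrime.ne_top ((Ideal.eq_top_iff_one _).2 h)⟩
  have hclosed (v : 𝓞 F) : IsClosed ((v • C : Submodule (𝓞 F) A) : Set A) :=
    (isCompact_smul v hC.isCompact).isClosed
  have hcl : IsClosed {z : A | y - z ∈ u • C} := (hclosed u).preimage (by fun_prop)
  obtain ⟨z, hz⟩ := IsCompact.nonempty_iInter_of_directed_nonempty_isCompact_isClosed
    (fun w : ι => ((((w : 𝓞 F) • C : Submodule (𝓞 F) A) : Set A) ∩ {z : A | y - z ∈ u • C}))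
    (fun w w' => ⟨⟨w * w', mul_mem w.2.1 w'.2.1, fun h =>
      (P.isPrime.mem_or_mem h).elim w.2.2 w'.2.2⟩,
      Set.inter_subset_inter_left _ (mul_smul_le_left _ _ _),
      Set.inter_subset_inter_left _ (mul_smul_le_right _ _ _)⟩)
    (fun w => by
      obtain ⟨r, hr, s, hrs⟩ := exists_mem_pow_add_mul_eq_one w.2.2 m
      refine ⟨(w : 𝓞 F) • s • y, Submodule.smul_mem_pointwise_smul _ _ _ (C.smul_mem s hy), ?_⟩
      have h1 : y - (w : 𝓞 F) • s • y = r • y := by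
        rw [sub_eq_iff_eq_add, smul_smul, ← add_smul, mul_comm, hrs, one_smul]
      rw [Set.mem_ofPred_eq, h1]
      exact hm r hr)
    (fun w => (isCompact_smul _ hC.isCompact).inter_right hcl)
    (fun w => (hclosed _).inter hcl)
  have hz' (w : 𝓞 F) (hw : w ∈ integralSUnits S) (hwP : w ∉ P.asIdeal) :
      z ∈ w • C ∧ y - z ∈ u • C := Set.mem_iInter.1 hz ⟨w, hw, hwP⟩
  obtain ⟨w, hw, hwP⟩ := ‹Nonempty ι›
  exact ⟨z, hC.mem_topPTorsion_of_forall_mem_smul fun w hw hwP => (hz' w hw hwP).1,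
    smul_le_self _ _ (hz' w hw hwP).1, (hz' w hw hwP).2⟩

/-- Modulo each `u • C`, every element of `C` is a finite sum of elements of the `A ^ P ∩ C`. -/
theorem mem_iSup_sup_smul (hC : IsAdelicLattice S C) {c : A} (hc : c ∈ C) {u : 𝓞 F}
    (hu : u ∈ integralSUnits S) :
    c ∈ (⨆ P : S, (A.topPTorsion (P : HeightOneSpectrum (𝓞 F))).restrictScalars (𝓞 F) ⊓ C)
      ⊔ u • C := by
  set L := (⨆ P : S, (A.topPTorsion (P : HeightOneSpectrum (𝓞 F))).restrictScalars (𝓞 F) ⊓ C)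
      ⊔ u • C with hL
  -- the ideal of multipliers of `c` into `L` is contained in no maximal ideal
  let I : Ideal (𝓞 F) := L.comap (LinearMap.toSpanSingleton (𝓞 F) A c)
  have hI (r : 𝓞 F) : r ∈ I ↔ r • c ∈ L := by simp [I]
  suffices I = ⊤ by
    have := (hI 1).1 (this ▸ Submodule.mem_top)
    rwa [one_smul] at this
  by_contra hne
  obtain ⟨M, hM, hIM⟩ := Ideal.exists_le_maximal I hne
  have huI : u ∈ I := (hI u).2
    (Submodule.mem_sup_right (Submodule.smul_mem_pointwise_smul _ _ _ hc))
  let P : HeightOneSpectrum (𝓞 F) := ⟨M, hM.isPrime, by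
    rintro rfl
    exact ne_zero_of_mem_integralSUnits hu (by simpa using hIM huI)⟩
  have hPS : P ∈ S := by
    by_contra hPS
    exact notMem_of_mem_integralSUnits hu hPS (hIM huI)
  obtain ⟨h, h0, hh⟩ := exists_pow_eq_span_singleton F
  obtain ⟨x, hx⟩ := hh P.asIdeal
  obtain ⟨m, w, hmw, hw⟩ := exists_pow_eq_pow_mul_notMem hx (ne_zero_of_mem_integralSUnits hu)
  obtain ⟨z, hzP, hzC, hz⟩ := hC.exists_sub_mem_of_pow_smul_mem (P := P) (C.smul_mem w hc)
    (m := h * m) (fun r hr => by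
      rw [pow_mul, hx, Ideal.span_singleton_pow, Ideal.mem_span_singleton] at hr
      obtain ⟨s, rfl⟩ := hr
      have h1 : (x ^ m * s) • w • c = s • u ^ (h - 1) • u • c := by
        rw [smul_smul, smul_smul, smul_smul, mul_right_comm, ← hmw, mul_assoc, ← pow_succ,
          Nat.sub_add_cancel (Nat.one_le_iff_ne_zero.2 h0), mul_comm]
      rw [h1]
      exact Submodule.smul_mem _ _ (Submodule.smul_mem _ _
        (Submodule.smul_mem_pointwise_smul _ _ _ hc)))
  refine hw (hIM ((hI w).2 ?_))
  rw [← sub_add_cancel (w • c) z]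
  refine add_mem (Submodule.mem_sup_right hz) (Submodule.mem_sup_left ?_)
  exact Submodule.mem_iSup_of_mem (⟨P, hPS⟩ : S) ⟨hzP, hzC⟩

theorem eventually_mem_smul (hC : IsAdelicLattice S C) (x : A.TorsionProduct C) {u : 𝓞 F}
    (hu : u ∈ integralSUnits S) : ∀ᶠ P : S in cofinite, (x P : A) ∈ u • C := by
  filter_upwards [x.2, eventually_notMem (ne_zero_of_mem_integralSUnits hu)] with P hP huP
  exact hC.mem_smul_of_mem_topPTorsion (x P).2 hP hu huP

theorem nonarchimedeanAddGroup (hC : IsAdelicLattice S C) : NonarchimedeanAddGroup A where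
  is_nonarchimedean U hU := by
    obtain ⟨u, hu, h⟩ := hC.exists_smul_subset hU
    exact ⟨⟨(u • C).toAddSubgroup, isOpen_smul hu hC.isClopen.isOpen⟩, h⟩

theorem summable (hC : IsAdelicLattice S C) (x : A.TorsionProduct C) :
    Summable fun P : S => (x P : A) := by
  let : UniformSpace A := IsTopologicalAddGroup.rightUniformSpace A
  have : IsUniformAddGroup A := isUniformAddGroup_of_addCommGroup
  have := hC.nonarchimedeanAddGroup
  have : CompleteSpace A := IsRightUniformAddGroup.completeSpace_of_weaklyLocallyCompactSpace
  refine NonarchimedeanAddGroup.summable_of_tendsto_cofinite_zero fun U hU => ?_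
  obtain ⟨u, hu, h⟩ := hC.exists_smul_subset hU
  filter_upwards [hC.eventually_mem_smul x hu] with P hP using h hP

/-- The sum of the components of an element of the restricted product. -/
noncomputable def sumHom (hC : IsAdelicLattice S C) : A.TorsionProduct C →+ A where
  toFun x := ∑' P : S, (x P : A)
  map_zero' := tsum_zero
  map_add' x y := (hC.summable x).tsum_add (hC.summable y)

theorem hasSum_sumHom (hC : IsAdelicLattice S C) (x : A.TorsionProduct C) :
    HasSum (fun P : S => (x P : A)) (hC.sumHom x) :=
  (hC.summable x).hasSum

theorem sumHom_mem_of_forall_mem (hC : IsAdelicLattice S C) {x : A.TorsionProduct C} {u : 𝓞 F}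
    (hx : ∀ P : S, (x P : A) ∈ u • C) : hC.sumHom x ∈ u • C :=
  (isCompact_smul u hC.isCompact).isClosed.mem_of_tendsto (hC.hasSum_sumHom x)
    (Eventually.of_forall fun _ => sum_mem fun P _ => hx P)

/-- The ring of `S`-integers acts componentwise on the restricted product: for almost all `P` the
denominator of `α` is invertible on `A ^ P ∩ C`. -/
theorem exists_smul_eq_smul (hC : IsAdelicLattice S C) (α : S.integer F)
    (x : A.TorsionProduct C) : ∃ y : A.TorsionProduct C, ∀ P : S, y P = α • x P := by
  obtain ⟨u, hu, b, hb⟩ := exists_mem_integralSUnits_smul_eq α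
  refine ⟨⟨fun P => α • x P, ?_⟩, fun P => rfl⟩
  filter_upwards [hC.eventually_mem_smul x hu] with P hP
  obtain ⟨c, hc, hcx⟩ := hP
  have hcx' : u • c = (x P : A) := hcx
  change α • (x P : A) ∈ C
  rw [← hcx', ← algebraMap_smul (S.integer F) u, smul_smul, mul_comm, hb, algebraMap_smul]
  exact C.smul_mem b hc

theorem sumHom_eq_smul (hC : IsAdelicLattice S C) {α : S.integer F}
    {x y : A.TorsionProduct C} (h : ∀ P : S, y P = α • x P) :
    hC.sumHom y = α • hC.sumHom x := by
  refine (hC.hasSum_sumHom y).unique ?_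
  have h1 := (hC.hasSum_sumHom x).map (DistribSMul.toAddMonoidHom A α) (continuous_const_smul α)
  exact h1.congr_fun fun P => congrArg Subtype.val (h P)

/-- The elements that are brought into `u • C` by an integer prime to `P` form a closed subgroup.
It contains the `A ^ Q` for all `Q ≠ P`, hence also their infinite sums, and it meets `A ^ P`
inside `u • C`. -/
theorem sumHom_injective (hC : IsAdelicLattice S C) : Function.Injective hC.sumHom := by
  classical
  refine (injective_iff_map_eq_zero _).2 fun x hx => RestrictedProduct.ext _ _ fun P =>
    Subtype.ext (hC.eq_zero_of_forall_mem fun u hu => ?_)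
  let H : AddSubgroup A :=
    { carrier := {a | ∃ w ∉ (P : HeightOneSpectrum (𝓞 F)).asIdeal, w • a ∈ u • C}
      zero_mem' := ⟨1, fun h => P.1.isPrime.ne_top ((Ideal.eq_top_iff_one _).2 h), by simp⟩
      add_mem' := by
        rintro a b ⟨w, hw, ha⟩ ⟨w', hw', hb⟩
        refine ⟨w * w', fun h => (P.1.isPrime.mem_or_mem h).elim hw hw', ?_⟩
        rw [smul_add]
        refine add_mem ?_ ?_
        · rw [mul_comm, mul_smul]
          exact Submodule.smul_mem _ _ ha
        · rw [mul_smul]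
          exact Submodule.smul_mem _ _ hb
      neg_mem' := by
        rintro a ⟨w, hw, ha⟩
        exact ⟨w, hw, by rw [smul_neg]; exact neg_mem ha⟩ }
  have hHopen : IsOpen (H : Set A) :=
    AddSubgroup.isOpen_of_mem_nhds _ (g := 0) (mem_of_superset (hC.smul_mem_nhds_zero hu)
      fun a ha => ⟨1, fun h => P.1.isPrime.ne_top ((Ideal.eq_top_iff_one _).2 h),
        Submodule.smul_mem _ _ ha⟩)
  have hH (Q : S) (hQ : Q ≠ P) : (x Q : A) ∈ H := by
    obtain ⟨N, hN⟩ := hC.mem_topPTorsion_iff.1 (x Q).2 u hu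
    obtain ⟨r, hr, hrP⟩ : ∃ r ∈ (Q : HeightOneSpectrum (𝓞 F)).asIdeal ^ N,
        r ∉ (P : HeightOneSpectrum (𝓞 F)).asIdeal := by
      refine SetLike.not_le_iff_exists.1 fun hle => hQ ?_
      have := P.1.isPrime
      have h2 := Q.1.isMaximal.eq_of_le P.1.isPrime.ne_top (Ideal.IsPrime.le_of_pow_le hle)
      exact Subtype.ext (HeightOneSpectrum.ext h2)
    exact ⟨r, hrP, hN r hr⟩
  have h1 : HasSum (fun Q : S => if Q = P then (0 : A) else x Q) (hC.sumHom x - x P) := by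
    have := (hC.hasSum_sumHom x).update P 0
    rw [zero_sub, neg_add_eq_sub] at this
    exact this.congr_fun fun Q => by rw [Function.update_apply]
  have h2 : hC.sumHom x - x P ∈ H :=
    (AddSubgroup.isClosed_of_isOpen _ hHopen).mem_of_tendsto h1
      (Eventually.of_forall fun _ => sum_mem fun Q _ => by
        split_ifs with h
        · exact zero_mem _
        · exact hH Q h)
  rw [hx, zero_sub, neg_mem_iff] at h2
  obtain ⟨w, hw, h⟩ := h2
  exact hC.mem_smul_of_smul_mem_smul (x P).2 hu hw h

theorem isOpen_topPTorsionInter (hC : IsAdelicLattice S C) (P : HeightOneSpectrum (𝓞 F)) :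
    IsOpen (A.topPTorsionInter C P : Set (A.topPTorsion P)) :=
  hC.isClopen.isOpen.preimage continuous_subtype_val

theorem continuous_sumHom (hC : IsAdelicLattice S C) : Continuous hC.sumHom := by
  have : Fact (∀ P : S, IsOpen (A.topPTorsionInter C P : Set (A.topPTorsion P))) :=
    ⟨fun P => hC.isOpen_topPTorsionInter P⟩
  refine continuous_of_continuousAt_zero hC.sumHom fun U hU => ?_
  rw [map_zero] at hU
  obtain ⟨u, hu, hU⟩ := hC.exists_smul_subset hU
  have h0 := RestrictedProduct.nhds_zero_eq_map_structureMap
    (fun P : S => A.topPTorsion (P : HeightOneSpectrum (𝓞 F)))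
    (B := fun P : S => A.topPTorsionInter C P) (fun P => hC.isOpen_topPTorsionInter P)
  change 𝓝 (0 : A.TorsionProduct C) = _ at h0
  rw [h0, Filter.mem_map, Filter.mem_map]
  have hfin : Set.Finite {P : S | u ∈ (P : HeightOneSpectrum (𝓞 F)).asIdeal} := by
    simpa using eventually_notMem (S := S) (ne_zero_of_mem_integralSUnits hu)
  have hopen : IsOpen (Set.pi {P : S | u ∈ (P : HeightOneSpectrum (𝓞 F)).asIdeal}
      fun P => {y : A.topPTorsionInter C P | ((y : A.topPTorsion P) : A) ∈ u • C}) :=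
    isOpen_set_pi hfin fun P _ => (isOpen_smul hu hC.isClopen.isOpen).preimage
      (continuous_subtype_val.comp continuous_subtype_val)
  refine mem_of_superset (hopen.mem_nhds fun P _ => zero_mem (u • C)) fun y hy =>
    hU (hC.sumHom_mem_of_forall_mem fun P => ?_)
  by_cases hP : u ∈ (P : HeightOneSpectrum (𝓞 F)).asIdeal
  · exact hy P hP
  · exact hC.mem_smul_of_mem_topPTorsion (y P).1.2 (y P).2 hu hP

theorem compactSpace_topPTorsionInter (hC : IsAdelicLattice S C) (P : HeightOneSpectrum (𝓞 F)) :
    CompactSpace (A.topPTorsionInter C P) :=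
  isCompact_iff_compactSpace.1 (hC.topPTorsionInter P).isCompact

/-- The image of the compact group `∏ (A ^ P ∩ C)` under summation is compact, and dense in `C`. -/
theorem mem_range_sumHom_structureMap (hC : IsAdelicLattice S C) {c : A} (hc : c ∈ C) :
    ∃ y : Π P : S, A.topPTorsionInter C P,
      hC.sumHom (RestrictedProduct.structureMap _ _ _ y) = c := by
  classical
  have := hC.compactSpace_topPTorsionInter
  have hcont : Continuous fun y : (Π P : S, A.topPTorsionInter C P) =>
      hC.sumHom (RestrictedProduct.structureMap _ _ _ y) :=
    hC.continuous_sumHom.comp (RestrictedProduct.isOpenEmbedding_structureMap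
      fun P : S => hC.isOpen_topPTorsionInter P).continuous
  have hclosed := (isCompact_range hcont).isClosed
  change c ∈ Set.range _
  rw [← hclosed.closure_eq, mem_closure_iff_nhds_zero]
  intro U hU
  obtain ⟨u, hu, hU⟩ := hC.exists_smul_subset hU
  obtain ⟨d, hd, e, he, hde⟩ := Submodule.mem_sup.1 (hC.mem_iSup_sup_smul hc hu)
  suffices d ∈ Set.range fun y : (Π P : S, A.topPTorsionInter C P) =>
      hC.sumHom (RestrictedProduct.structureMap _ _ _ y) by
    refine ⟨d, this, hU ?_⟩
    rw [← hde, sub_add_cancel_left]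
    exact neg_mem he
  clear hde
  induction hd using Submodule.iSup_induction' with
  | mem P x hx =>
    refine ⟨Pi.single P ⟨⟨x, hx.1⟩, hx.2⟩, ?_⟩
    have h1 := hasSum_single (f := fun Q : S =>
      ((((Pi.single P ⟨⟨x, hx.1⟩, hx.2⟩ : Π P : S, A.topPTorsionInter C P) Q) :
        A.topPTorsion (Q : HeightOneSpectrum (𝓞 F))) : A)) P fun Q hQ => by
      rw [Pi.single_eq_of_ne hQ]
      rfl
    rw [Pi.single_eq_same] at h1
    exact (hC.hasSum_sumHom _).unique h1
  | zero => exact ⟨0, map_zero hC.sumHom⟩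
  | add x y _ _ hx hy =>
    obtain ⟨x, rfl⟩ := hx
    obtain ⟨y, rfl⟩ := hy
    exact ⟨x + y, map_add hC.sumHom (RestrictedProduct.structureMap _ _ _ x)
      (RestrictedProduct.structureMap _ _ _ y)⟩

theorem sumHom_surjective (hC : IsAdelicLattice S C) : Function.Surjective hC.sumHom := by
  intro a
  obtain ⟨u, hu, hua⟩ := hC.exists_smul_mem a
  obtain ⟨y, hy⟩ := hC.mem_range_sumHom_structureMap hua
  obtain ⟨β, hβ⟩ := (mem_integralSUnits.1 hu).exists_left_inv
  obtain ⟨z, hz⟩ := hC.exists_smul_eq_smul β (RestrictedProduct.structureMap _ _ _ y)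
  refine ⟨z, ?_⟩
  rw [hC.sumHom_eq_smul hz, hy, ← algebraMap_smul (S.integer F) u, smul_smul, hβ, one_smul]

/-- Summation is open: it restricts to a bijection of the compact open subgroup
`∏ (A ^ P ∩ C)` onto the open subgroup `C`. -/
theorem isOpenMap_sumHom (hC : IsAdelicLattice S C) : IsOpenMap hC.sumHom := by
  have : Fact (∀ P : S, IsOpen (A.topPTorsionInter C P : Set (A.topPTorsion P))) :=
    ⟨fun P => hC.isOpen_topPTorsionInter P⟩
  have := hC.compactSpace_topPTorsionInter
  have hs := RestrictedProduct.isOpenEmbedding_structureMap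
    fun P : S => hC.isOpen_topPTorsionInter P
  let j (y : Π P : S, A.topPTorsionInter C P) : A :=
    hC.sumHom (RestrictedProduct.structureMap _ _ _ y)
  have hj : IsClosedEmbedding j := (hC.continuous_sumHom.comp hs.continuous).isClosedEmbedding
    (hC.sumHom_injective.comp hs.injective)
  have hrange : Set.range j = C := by
    refine Set.Subset.antisymm ?_ fun c hc => hC.mem_range_sumHom_structureMap hc
    rintro _ ⟨y, rfl⟩
    have h1 := hC.sumHom_mem_of_forall_mem (u := 1)
      (x := RestrictedProduct.structureMap _ _ _ y) fun P => by
        rw [one_smul]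
        exact (y P).2
    rwa [one_smul] at h1
  have hjo : IsOpenEmbedding j := ⟨hj.isEmbedding, hrange ▸ hC.isClopen.isOpen⟩
  refine IsTopologicalAddGroup.isOpenMap_iff_nhds_zero.2 fun U hU => ?_
  have h0 : j 0 = 0 := map_zero hC.sumHom
  rw [← h0, ← hjo.map_nhds_eq 0]
  exact hs.continuous.continuousAt.preimage_mem_nhds (t := hC.sumHom ⁻¹' U) hU

/-- The decomposition of `A` as the restricted product of its topological `P`-torsion parts. -/
noncomputable def equivTorsionProduct (hC : IsAdelicLattice S C) :
    A ≃ₜ+ A.TorsionProduct C :=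
  ContinuousAddEquiv.symm
  { AddEquiv.ofBijective hC.sumHom ⟨hC.sumHom_injective, hC.sumHom_surjective⟩ with
    continuous_toFun := hC.continuous_sumHom
    continuous_invFun := (AddEquiv.ofBijective hC.sumHom
      ⟨hC.sumHom_injective, hC.sumHom_surjective⟩).toEquiv.continuous_symm_iff.2
        hC.isOpenMap_sumHom }

theorem equivTorsionProduct_smul (hC : IsAdelicLattice S C) (α : S.integer F) (a : A) (P : S) :
    hC.equivTorsionProduct (α • a) P = α • hC.equivTorsionProduct a P := by
  obtain ⟨y, hy⟩ := hC.exists_smul_eq_smul α (hC.equivTorsionProduct a)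
  have h1 : hC.sumHom (hC.equivTorsionProduct a) = a :=
    hC.equivTorsionProduct.symm_apply_apply a
  have h2 : hC.equivTorsionProduct (α • a) = y := by
    rw [← h1, ← hC.sumHom_eq_smul hy]
    exact hC.equivTorsionProduct.apply_symm_apply y
  rw [h2, hy]

end IsAdelicLattice

end Decomposition

end LCAMod

/-! ### Topological rational vector spaces that are `p`-adic -/

section Padic

variable (p : ℕ) [Fact p.Prime] (M : Type*) [AddCommGroup M] [TopologicalSpace M]

/-- A topological `ℚ`-vector space on which `ℚ` acts continuously for the `p`-adic topology:
there are arbitrarily small open subgroups stable under the `p`-integral rationals, and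
multiplication by `p` is topologically nilpotent. -/
structure IsPadicRatModule [Module ℚ M] : Prop where
  exists_addSubgroup : ∀ U ∈ 𝓝 (0 : M), ∃ W : AddSubgroup M, IsOpen (W : Set M) ∧ (W : Set M) ⊆ U ∧
    ∀ q : ℚ, ‖(q : ℚ_[p])‖ ≤ 1 → ∀ x ∈ W, q • x ∈ W
  exists_pow_smul_mem : ∀ x : M, ∀ U ∈ 𝓝 (0 : M), ∃ n : ℕ, (p ^ n : ℚ) • x ∈ U
  continuous_smul : ∀ q : ℚ, Continuous fun x : M => q • x

/-- The filter on `ℚ` of `p`-adic neighbourhoods of a `p`-adic number. -/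
noncomputable def padicRatNhds (z : ℚ_[p]) : Filter ℚ := comap (fun q : ℚ => (q : ℚ_[p])) (𝓝 z)

instance padicRatNhds_neBot (z : ℚ_[p]) : (padicRatNhds p z).NeBot := by
  refine comap_neBot fun t ht => ?_
  obtain ⟨ε, hε, h⟩ := Metric.mem_nhds_iff.1 ht
  obtain ⟨r, hr⟩ := Padic.rat_dense p z hε
  exact ⟨r, h (by rwa [Metric.mem_ball, dist_comm, dist_eq_norm])⟩

variable {p M}

theorem tendsto_padicRatNhds {α : Type*} {l : Filter α} {f : α → ℚ} {z : ℚ_[p]} :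
    Tendsto f l (padicRatNhds p z) ↔ Tendsto (fun a => (f a : ℚ_[p])) l (𝓝 z) :=
  tendsto_comap_iff

theorem tendsto_cast_padicRatNhds (z : ℚ_[p]) :
    Tendsto (fun q : ℚ => (q : ℚ_[p])) (padicRatNhds p z) (𝓝 z) :=
  tendsto_comap

namespace IsPadicRatModule

variable [Module ℚ M] (hM : IsPadicRatModule p M)

include hM

theorem tendsto_smul_zero (x : M) :
    Tendsto (fun q : ℚ => q • x) (padicRatNhds p 0) (𝓝 0) := by
  intro U hU
  obtain ⟨W, hW, hWU, hint⟩ := hM.exists_addSubgroup U hU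
  obtain ⟨n, hn⟩ := hM.exists_pow_smul_mem x W (hW.mem_nhds (zero_mem W))
  have hp : (p : ℚ_[p]) ≠ 0 := by exact_mod_cast (Fact.out : p.Prime).ne_zero
  have hp' : (p : ℚ) ≠ 0 := by exact_mod_cast (Fact.out : p.Prime).ne_zero
  have hball : Metric.ball (0 : ℚ_[p]) ‖(p : ℚ_[p]) ^ n‖ ∈ 𝓝 (0 : ℚ_[p]) :=
    Metric.ball_mem_nhds _ (norm_pos_iff.2 (pow_ne_zero n hp))
  refine mem_map.2 (mem_of_superset (preimage_mem_comap hball) fun q hq => ?_)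
  have hq' : ‖(q : ℚ_[p])‖ < ‖(p : ℚ_[p]) ^ n‖ := by simpa using hq
  refine hWU ?_
  have h1 : q • x = (q / (p : ℚ) ^ n) • ((p ^ n : ℚ) • x) := by
    rw [smul_smul, div_mul_cancel₀ _ (pow_ne_zero n hp')]
  change q • x ∈ W
  rw [h1]
  refine hint _ ?_ _ hn
  push_cast
  rw [norm_div]
  exact div_le_one_of_le₀ hq'.le (norm_nonneg _)

variable [IsTopologicalAddGroup M] [LocallyCompactSpace M]

theorem exists_tendsto (z : ℚ_[p]) (x : M) :
    ∃ y, Tendsto (fun q : ℚ => q • x) (padicRatNhds p z) (𝓝 y) := by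
  let : UniformSpace M := IsTopologicalAddGroup.rightUniformSpace M
  have : IsUniformAddGroup M := isUniformAddGroup_of_addCommGroup
  have : CompleteSpace M := IsRightUniformAddGroup.completeSpace_of_weaklyLocallyCompactSpace
  refine cauchy_map_iff_exists_tendsto.1 (cauchy_map_iff.2 ⟨inferInstance, ?_⟩)
  rw [uniformity_eq_comap_nhds_zero, tendsto_comap_iff]
  have h1 : Tendsto (fun a : ℚ × ℚ => a.2 - a.1) (padicRatNhds p z ×ˢ padicRatNhds p z)
      (padicRatNhds p 0) := by
    rw [tendsto_padicRatNhds]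
    have h := ((tendsto_cast_padicRatNhds z).comp
      (tendsto_snd (f := padicRatNhds p z) (g := padicRatNhds p z))).sub
      ((tendsto_cast_padicRatNhds z).comp
      (tendsto_fst (f := padicRatNhds p z) (g := padicRatNhds p z)))
    rw [sub_self] at h
    refine h.congr fun a => ?_
    simp
  refine ((hM.tendsto_smul_zero x).comp h1).congr fun a => ?_
  simp [sub_smul]

/-- The action of a `p`-adic number, as the limit of the actions of its rational
approximations. -/
noncomputable def padicSMul (z : ℚ_[p]) (x : M) : M := (hM.exists_tendsto z x).choose

theorem tendsto_padicSMul (z : ℚ_[p]) (x : M) :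
    Tendsto (fun q : ℚ => q • x) (padicRatNhds p z) (𝓝 (hM.padicSMul z x)) :=
  (hM.exists_tendsto z x).choose_spec

theorem padicSMul_mem {W : AddSubgroup M} (hW : IsOpen (W : Set M)) {V : Set ℚ_[p]}
    (hV : IsOpen V) {x : M} (h : ∀ q : ℚ, (q : ℚ_[p]) ∈ V → q • x ∈ W) {z : ℚ_[p]} (hz : z ∈ V) :
    hM.padicSMul z x ∈ W :=
  (AddSubgroup.isClosed_of_isOpen W hW).mem_of_tendsto (hM.tendsto_padicSMul z x)
    (mem_of_superset (preimage_mem_comap (hV.mem_nhds hz)) fun q hq => h q hq)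

variable [T2Space M]

theorem padicSMul_eq {z : ℚ_[p]} {x y : M}
    (h : Tendsto (fun q : ℚ => q • x) (padicRatNhds p z) (𝓝 y)) : hM.padicSMul z x = y :=
  tendsto_nhds_unique (hM.tendsto_padicSMul z x) h

theorem padicSMul_add (z : ℚ_[p]) (x y : M) :
    hM.padicSMul z (x + y) = hM.padicSMul z x + hM.padicSMul z y :=
  hM.padicSMul_eq (((hM.tendsto_padicSMul z x).add (hM.tendsto_padicSMul z y)).congr
    fun q => (smul_add q x y).symm)

theorem padicSMul_zero (z : ℚ_[p]) : hM.padicSMul z (0 : M) = 0 :=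
  hM.padicSMul_eq (by simp)

theorem add_padicSMul (z w : ℚ_[p]) (x : M) :
    hM.padicSMul (z + w) x = hM.padicSMul z x + hM.padicSMul w x := by
  have h1 : Tendsto (fun a : ℚ × ℚ => a.1 + a.2) (padicRatNhds p z ×ˢ padicRatNhds p w)
      (padicRatNhds p (z + w)) := by
    rw [tendsto_padicRatNhds]
    push_cast
    exact ((tendsto_cast_padicRatNhds z).comp tendsto_fst).add
      ((tendsto_cast_padicRatNhds w).comp tendsto_snd)
  have h2 := (hM.tendsto_padicSMul (z + w) x).comp h1
  have h3 := ((hM.tendsto_padicSMul z x).comp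
    (tendsto_fst (f := padicRatNhds p z) (g := padicRatNhds p w))).add
    ((hM.tendsto_padicSMul w x).comp
    (tendsto_snd (f := padicRatNhds p z) (g := padicRatNhds p w)))
  exact tendsto_nhds_unique h2 (h3.congr fun a => (add_smul a.1 a.2 x).symm)

theorem padicSMul_ratCast (q : ℚ) (x : M) : hM.padicSMul (q : ℚ_[p]) x = q • x := by
  refine hM.padicSMul_eq ?_
  have h1 : Tendsto (fun a : ℚ => a - q) (padicRatNhds p q) (padicRatNhds p 0) := by
    rw [tendsto_padicRatNhds]
    push_cast
    simpa using (tendsto_cast_padicRatNhds (q : ℚ_[p])).sub_const (q : ℚ_[p])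
  have h2 := ((hM.tendsto_smul_zero x).comp h1).add_const (q • x)
  rw [zero_add] at h2
  exact h2.congr fun a => by simp [sub_smul]

theorem one_padicSMul (x : M) : hM.padicSMul 1 x = x := by
  simpa using hM.padicSMul_ratCast 1 x

theorem zero_padicSMul (x : M) : hM.padicSMul 0 x = 0 := by
  simpa using hM.padicSMul_ratCast 0 x

theorem continuous_padicSMul_left (x : M) : Continuous fun z => hM.padicSMul z x := by
  let f : ℚ_[p] →+ M :=
    { toFun := fun z => hM.padicSMul z x
      map_zero' := hM.zero_padicSMul x
      map_add' := fun z w => hM.add_padicSMul z w x }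
  refine continuous_of_continuousAt_zero f fun U hU => ?_
  rw [map_zero] at hU
  obtain ⟨W, hW, hWU, -⟩ := hM.exists_addSubgroup U hU
  obtain ⟨V, hV, hVW⟩ := mem_comap.1 (hM.tendsto_smul_zero x (hW.mem_nhds (zero_mem W)))
  obtain ⟨V', hV'V, hV', h0⟩ := mem_nhds_iff.1 hV
  exact mem_map.2 (mem_of_superset (hV'.mem_nhds h0) fun z hz => hWU
    (hM.padicSMul_mem hW hV' (fun q hq => hVW (hV'V hq)) hz))

theorem mul_padicSMul (z w : ℚ_[p]) (x : M) :
    hM.padicSMul (z * w) x = hM.padicSMul z (hM.padicSMul w x) := by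
  have hrat (q : ℚ) : hM.padicSMul (q * w) x = q • hM.padicSMul w x := by
    have h1 : Tendsto (fun r : ℚ => q * r) (padicRatNhds p w) (padicRatNhds p (q * w)) := by
      rw [tendsto_padicRatNhds]
      push_cast
      exact (tendsto_cast_padicRatNhds w).const_mul _
    have h2 := (hM.tendsto_padicSMul (q * w) x).comp h1
    have h3 := ((hM.continuous_smul q).tendsto _).comp (hM.tendsto_padicSMul w x)
    exact tendsto_nhds_unique h2 (h3.congr fun r => (mul_smul q r x).symm)
  symm
  refine hM.padicSMul_eq ?_
  have h1 : Tendsto (fun q : ℚ => (q : ℚ_[p]) * w) (padicRatNhds p z) (𝓝 (z * w)) :=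
    (tendsto_cast_padicRatNhds z).mul_const w
  exact (((hM.continuous_padicSMul_left x).tendsto _).comp h1).congr hrat

/-- The `ℚ_p`-vector space structure extending the `ℚ`-vector space structure by continuity. -/
@[reducible] noncomputable def module : Module ℚ_[p] M where
  smul := hM.padicSMul
  one_smul := hM.one_padicSMul
  mul_smul := hM.mul_padicSMul
  smul_zero := hM.padicSMul_zero
  smul_add := hM.padicSMul_add
  add_smul := hM.add_padicSMul
  zero_smul := hM.zero_padicSMul

theorem continuousSMul : letI := hM.module; ContinuousSMul ℚ_[p] M := by
  let := hM.module
  have hball : Metric.closedBall (0 : ℚ_[p]) 1 ∈ 𝓝 (0 : ℚ_[p]) :=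
    Metric.closedBall_mem_nhds _ one_pos
  have hstable {W : AddSubgroup M} (hW : IsOpen (W : Set M))
      (hint : ∀ q : ℚ, ‖(q : ℚ_[p])‖ ≤ 1 → ∀ x ∈ W, q • x ∈ W) {z : ℚ_[p]} (hz : ‖z‖ ≤ 1)
      {x : M} (hx : x ∈ W) : z • x ∈ W :=
    hM.padicSMul_mem hW (IsUltrametricDist.isOpen_closedBall (0 : ℚ_[p]) one_ne_zero)
      (fun q hq => hint q (by simpa using hq) x hx) (by simpa using hz)
  refine ContinuousSMul.of_nhds_zero (fun U hU => ?_) (fun x => ?_) fun z => ?_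
  · obtain ⟨W, hW, hWU, hint⟩ := hM.exists_addSubgroup U hU
    refine mem_map.2 (mem_of_superset (prod_mem_prod hball (hW.mem_nhds (zero_mem W)))
      fun a ha => hWU ?_)
    exact hstable hW hint (by simpa using ha.1) ha.2
  · have := (hM.continuous_padicSMul_left x).tendsto 0
    rwa [hM.zero_padicSMul] at this
  · -- a rational multiple of `z` is `p`-integral
    obtain ⟨q, hq, hqz⟩ : ∃ q : ℚ, q ≠ 0 ∧ ‖(q : ℚ_[p]) * z‖ ≤ 1 := by
      have hp : (p : ℚ) ≠ 0 := by exact_mod_cast (Fact.out : p.Prime).ne_zero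
      have h1 : Tendsto (fun n : ℕ => ‖(p : ℚ_[p])‖ ^ n * ‖z‖) atTop (𝓝 (0 * ‖z‖)) :=
        (tendsto_pow_atTop_nhds_zero_of_lt_one (norm_nonneg _) Padic.norm_p_lt_one).mul_const _
      rw [zero_mul] at h1
      obtain ⟨n, hn⟩ := (h1.eventually_le_const one_pos).exists
      refine ⟨(p : ℚ) ^ n, pow_ne_zero n hp, ?_⟩
      push_cast
      rwa [norm_mul, norm_pow]
    have h1 : Tendsto (fun x : M => ((q : ℚ_[p]) * z) • x) (𝓝 0) (𝓝 0) := by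
      intro U hU
      obtain ⟨W, hW, hWU, hint⟩ := hM.exists_addSubgroup U hU
      exact mem_map.2 (mem_of_superset (hW.mem_nhds (zero_mem W))
        fun x hx => hWU (hstable hW hint hqz hx))
    have h2 := ((hM.continuous_smul q⁻¹).tendsto 0).comp h1
    rw [smul_zero] at h2
    refine h2.congr fun x => ?_
    change q⁻¹ • (((q : ℚ_[p]) * z) • x) = z • x
    rw [← hM.padicSMul_ratCast]
    change ((q⁻¹ : ℚ) : ℚ_[p]) • (((q : ℚ_[p]) * z) • x) = z • x
    rw [smul_smul]
    push_cast
    rw [inv_mul_cancel_left₀ (by exact_mod_cast hq)]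

/-- The extended structure makes `M` a locally compact Hausdorff topological vector space over
`ℚ_p`, which is therefore finite-dimensional. -/
theorem exists_continuousLinearEquiv :
    ∃ (_ : Module ℚ_[p] M) (n : ℕ), Nonempty (M ≃L[ℚ_[p]] (Fin n → ℚ_[p])) := by
  let := hM.module
  have := hM.continuousSMul
  have : FiniteDimensional ℚ_[p] M := FiniteDimensional.of_locallyCompactSpace ℚ_[p]
  exact ⟨hM.module, Module.finrank ℚ_[p] M, ⟨ContinuousLinearEquiv.ofFinrankEq (by simp)⟩⟩

end IsPadicRatModule

/-- A uniquely divisible abelian group is a rational vector space. -/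
@[reducible] noncomputable def ratModuleOfBijective (M : Type*) [AddCommGroup M]
    (h : ∀ n : ℤ, n ≠ 0 → Function.Bijective fun x : M => n • x) : Module ℚ M :=
  haveI : IsLocalizedModule (nonZeroDivisors ℤ) (LinearMap.id : M →ₗ[ℤ] M) :=
    { map_units := fun n => (Module.End.isUnit_iff _).2 (h n (nonZeroDivisors.coe_ne_zero n))
      surj := fun y => ⟨(y, 1), by simp⟩
      exists_of_eq := fun {x y} hxy => ⟨1, by simpa using hxy⟩ }
  IsLocalizedModule.module (nonZeroDivisors ℤ) (LinearMap.id : M →ₗ[ℤ] M)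

/-- An abelian topological group on which all nonzero integers act by homeomorphisms, there
are arbitrarily small open subgroups in which division by integers prime to `p` is possible, and
`p` acts topologically nilpotently, is a `p`-adic vector space. -/
theorem exists_continuousLinearEquiv_padic (p : ℕ) [Fact p.Prime] (M : Type*) [AddCommGroup M]
    [TopologicalSpace M] [IsTopologicalAddGroup M] [LocallyCompactSpace M] [T2Space M]
    (hbij : ∀ n : ℤ, n ≠ 0 → Function.Bijective fun x : M => n • x)
    (hopen : ∀ n : ℤ, n ≠ 0 → IsOpenMap fun x : M => n • x)
    (hsub : ∀ U ∈ 𝓝 (0 : M), ∃ W : AddSubgroup M, IsOpen (W : Set M) ∧ (W : Set M) ⊆ U ∧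
      ∀ n : ℤ, ¬ (p : ℤ) ∣ n → ∀ x, n • x ∈ W → x ∈ W)
    (hnil : ∀ x : M, ∀ U ∈ 𝓝 (0 : M), ∃ n : ℕ, p ^ n • x ∈ U) :
    ∃ (_ : Module ℚ_[p] M) (n : ℕ), Nonempty (M ≃L[ℚ_[p]] (Fin n → ℚ_[p])) := by
  let := ratModuleOfBijective M hbij
  have hden (q : ℚ) (x : M) : (q.den : ℤ) • q • x = q.num • x := by
    rw [← Int.cast_smul_eq_zsmul ℚ, ← Int.cast_smul_eq_zsmul ℚ, smul_smul]
    congr 1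
    exact_mod_cast Rat.den_mul_eq_num q
  refine IsPadicRatModule.exists_continuousLinearEquiv (p := p) ⟨fun U hU => ?_, fun x U hU => ?_,
    fun q => ?_⟩
  · obtain ⟨W, hW, hWU, h⟩ := hsub U hU
    refine ⟨W, hW, hWU, fun q hq x hx => h q.den ?_ _ ?_⟩
    · intro hdvd
      have h1 := PadicInt.isUnit_iff.1 (PadicInt.isUnit_den q hq)
      have h2 := (PadicInt.norm_int_lt_one_iff_dvd (p := p) q.den).2 (by exact_mod_cast hdvd)
      rw [Int.cast_natCast, h1] at h2
      exact lt_irrefl _ h2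
    · rw [hden]
      exact zsmul_mem hx _
  · obtain ⟨n, hn⟩ := hnil x U hU
    refine ⟨n, ?_⟩
    rw [← Nat.cast_smul_eq_nsmul ℚ] at hn
    exact_mod_cast hn
  · have hd : (q.den : ℤ) ≠ 0 := by exact_mod_cast q.den_nz
    let e := (Equiv.ofBijective _ (hbij q.den hd)).toHomeomorphOfContinuousOpen
      (continuous_zsmul _) (hopen q.den hd)
    have : (fun x : M => q • x) = fun x => e.symm (q.num • x) := by
      funext x
      rw [Homeomorph.eq_symm_apply]
      exact hden q x
    rw [this]
    exact e.symm.continuous.comp (continuous_zsmul _)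

end Padic

/-! ### The topological `P`-torsion part as a `p`-adic vector space -/

namespace LCAMod

section PrimaryPart

variable {F : Type v} [Field F] [NumberField F] {S : Set (HeightOneSpectrum (𝓞 F))}
  {A : LCAMod.{u, v} F S} {C : Submodule (𝓞 F) A}

instance (P : HeightOneSpectrum (𝓞 F)) : ContinuousConstSMul (S.integer F) (A.topPTorsion P) :=
  ⟨fun α => (continuous_const_smul α).restrict fun _ hx => Submodule.smul_mem _ α hx⟩

instance (P : HeightOneSpectrum (𝓞 F)) : ContinuousConstSMul (𝓞 F) (A.topPTorsion P) :=
  ⟨fun r => (continuous_const_smul r).restrict fun _ hx => Submodule.smul_of_tower_mem _ r hx⟩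

namespace IsAdelicLattice

theorem smul_injective_of_notMem (hC : IsAdelicLattice S C) {P : HeightOneSpectrum (𝓞 F)}
    {w : 𝓞 F} (hw : w ∉ P.asIdeal) : Function.Injective fun x : A.topPTorsion P => w • x := by
  intro x y hxy
  have h0 : w • ((x - y : A.topPTorsion P) : A) = 0 := by
    have : w • (x - y) = 0 := by rw [smul_sub]; exact sub_eq_zero.2 hxy
    exact congrArg Subtype.val this
  refine sub_eq_zero.1 (Subtype.ext (hC.eq_zero_of_forall_mem fun u hu => ?_))
  exact hC.mem_smul_of_smul_mem_smul (x - y).2 hu hw (h0 ▸ zero_mem _)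

theorem exists_smul_subset_topPTorsion (hC : IsAdelicLattice S C) {P : HeightOneSpectrum (𝓞 F)}
    {U : Set (A.topPTorsion P)} (hU : U ∈ 𝓝 0) :
    ∃ u ∈ integralSUnits S, ∀ x : A.topPTorsion P, (x : A) ∈ u • C → x ∈ U := by
  obtain ⟨U', hU', hU'U⟩ := (mem_nhds_induced _ _ _).1 hU
  obtain ⟨u, hu, huU⟩ := hC.exists_smul_subset hU'
  exact ⟨u, hu, fun x hx => hU'U (huU hx)⟩

/-- An integer prime to `P` maps the compact group `A ^ P ∩ u • C` onto itself, since the image is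
closed and, by the Chinese remainder theorem, dense. -/
theorem exists_smul_eq_of_notMem (hC : IsAdelicLattice S C) {P : HeightOneSpectrum (𝓞 F)}
    {w u : 𝓞 F} (hw : w ∉ P.asIdeal) {x : A.topPTorsion P} (hx : (x : A) ∈ u • C) :
    ∃ y : A.topPTorsion P, (y : A) ∈ u • C ∧ w • y = x := by
  let K : Set (A.topPTorsion P) := {x | (x : A) ∈ u • C}
  have hK : IsCompact K :=
    (hC.isClosed_topPTorsion P).isClosedEmbedding_subtypeVal.isCompact_preimage
      (isCompact_smul u hC.isCompact)
  suffices x ∈ (fun y => w • y) '' K from this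
  rw [← (hK.image (continuous_const_smul w)).isClosed.closure_eq, mem_closure_iff_nhds_zero]
  intro U hU
  obtain ⟨v, hv, hvU⟩ := hC.exists_smul_subset_topPTorsion hU
  obtain ⟨N, hN⟩ := hC.mem_topPTorsion_iff.1 x.2 v hv
  obtain ⟨r, hr, s, hrs⟩ := exists_mem_pow_add_mul_eq_one hw N
  refine ⟨w • s • x, ⟨s • x, Submodule.smul_mem _ s hx, rfl⟩, hvU _ ?_⟩
  have h1 : w • s • x - x = -(r • x) := by
    rw [sub_eq_iff_eq_add, smul_smul, neg_add_eq_sub, eq_sub_iff_add_eq, ← add_smul, mul_comm,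
      add_comm, hrs, one_smul]
  change ((w • s • x - x : A.topPTorsion P) : A) ∈ v • C
  rw [h1]
  exact neg_mem (hN r hr)

theorem setOf_mem_smul_mem_nhds (hC : IsAdelicLattice S C) (P : HeightOneSpectrum (𝓞 F))
    {u : 𝓞 F} (hu : u ∈ integralSUnits S) : {x : A.topPTorsion P | (x : A) ∈ u • C} ∈ 𝓝 0 :=
  continuous_subtype_val.continuousAt.preimage_mem_nhds (hC.smul_mem_nhds_zero hu)

theorem smul_surjective_of_notMem (hC : IsAdelicLattice S C) {P : HeightOneSpectrum (𝓞 F)}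
    {w : 𝓞 F} (hw : w ∉ P.asIdeal) : Function.Surjective fun x : A.topPTorsion P => w • x := by
  intro x
  obtain ⟨v, hv, hvx⟩ := hC.exists_smul_mem (x : A)
  obtain ⟨y, -, hy⟩ := hC.exists_smul_eq_of_notMem (u := 1) hw (x := v • x) (by rwa [one_smul])
  let β := (mem_integralSUnits.1 hv).unit
  have hβ (z : A.topPTorsion P) : v • z = β • z := (algebraMap_smul (S.integer F) v z).symm
  refine ⟨β⁻¹ • y, ?_⟩
  change w • β⁻¹ • y = x
  rw [smul_comm, hy, hβ, inv_smul_smul]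

theorem isOpenMap_smul_of_notMem (hC : IsAdelicLattice S C) {P : HeightOneSpectrum (𝓞 F)}
    {w : 𝓞 F} (hw : w ∉ P.asIdeal) : IsOpenMap fun x : A.topPTorsion P => w • x := by
  change IsOpenMap (DistribSMul.toAddMonoidHom (A.topPTorsion P) w)
  refine IsTopologicalAddGroup.isOpenMap_iff_nhds_zero.2 fun U hU => ?_
  obtain ⟨u, hu, huU⟩ := hC.exists_smul_subset_topPTorsion (mem_map.1 hU)
  refine mem_of_superset (hC.setOf_mem_smul_mem_nhds P hu) fun x hx => ?_
  obtain ⟨y, hy, rfl⟩ := hC.exists_smul_eq_of_notMem hw hx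
  exact huU y hy

/-- Every nonzero algebraic integer acts on `A ^ P` as a homeomorphism: a power of it is the product
of an integral `S`-unit and an integer prime to `P`. -/
theorem smul_bijective_and_isOpenMap (hC : IsAdelicLattice S C) {P : HeightOneSpectrum (𝓞 F)}
    (hP : P ∈ S) {r : 𝓞 F} (hr : r ≠ 0) :
    Function.Bijective (fun x : A.topPTorsion P => r • x) ∧
      IsOpenMap fun x : A.topPTorsion P => r • x := by
  obtain ⟨h, h0, hh⟩ := exists_pow_eq_span_singleton F
  obtain ⟨x, hx⟩ := hh P.asIdeal
  obtain ⟨m, w, hmw, hw⟩ := exists_pow_eq_pow_mul_notMem hx hr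
  have hxm := pow_mem (mem_integralSUnits_of_pow_eq_span hP hx) m
  let e : A.topPTorsion P ≃ₜ A.topPTorsion P := Homeomorph.smul (mem_integralSUnits.1 hxm).unit
  have he (y : A.topPTorsion P) : e y = x ^ m • y := algebraMap_smul (S.integer F) _ _
  have hcomp : (fun y : A.topPTorsion P => r ^ h • y) = e ∘ fun y => w • y := by
    funext y
    rw [Function.comp_apply, he, smul_smul, hmw]
  have hbij : Function.Bijective fun y : A.topPTorsion P => r ^ h • y := hcomp ▸
    e.bijective.comp ⟨hC.smul_injective_of_notMem hw, hC.smul_surjective_of_notMem hw⟩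
  have hopen : IsOpenMap fun y : A.topPTorsion P => r ^ h • y := hcomp ▸
    e.isOpenMap.comp (hC.isOpenMap_smul_of_notMem hw)
  obtain ⟨k, rfl⟩ := Nat.exists_eq_succ_of_ne_zero h0
  have h1 : (fun y : A.topPTorsion P => r ^ (k + 1) • y) =
      (fun y => r ^ k • y) ∘ fun y => r • y := by
    funext y
    rw [Function.comp_apply, smul_smul, pow_succ]
  have h2 : (fun y : A.topPTorsion P => r ^ (k + 1) • y) =
      (fun y => r • y) ∘ fun y => r ^ k • y := by
    funext y
    rw [Function.comp_apply, smul_smul, pow_succ']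
  have hb1 := h1 ▸ hbij
  have hb2 := h2 ▸ hbij
  have hbr : Function.Bijective fun x : A.topPTorsion P => r • x :=
    ⟨hb1.1.of_comp, hb2.2.of_comp⟩
  have hbk : Function.Bijective fun x : A.topPTorsion P => r ^ k • x :=
    (Function.Bijective.of_comp_iff _ hbr).1 hb1
  exact ⟨hbr, IsOpenMap.of_comp (continuous_const_smul _) hbk.2 (h2 ▸ hopen)⟩

theorem exists_continuousLinearEquiv_padic (hC : IsAdelicLattice S C)
    {P : HeightOneSpectrum (𝓞 F)} (hP : P ∈ S) (p : ℕ) [Fact p.Prime]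
    (hPp : P.asIdeal.comap (algebraMap ℤ (𝓞 F)) = Ideal.span {(p : ℤ)}) :
    ∃ (_ : Module ℚ_[p] (A.topPTorsion P)) (n : ℕ),
      Nonempty (A.topPTorsion P ≃L[ℚ_[p]] (Fin n → ℚ_[p])) := by
  have hmem (n : ℤ) : (n : 𝓞 F) ∈ P.asIdeal ↔ (p : ℤ) ∣ n := by
    rw [← Ideal.mem_span_singleton, ← hPp, Ideal.mem_comap]
    simp
  have hsmul (n : ℤ) : (fun x : A.topPTorsion P => n • x) = fun x => (n : 𝓞 F) • x := by
    funext x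
    exact (Int.cast_smul_eq_zsmul (𝓞 F) n x).symm
  have hne (n : ℤ) (hn : n ≠ 0) : (n : 𝓞 F) ≠ 0 := by exact_mod_cast hn
  have : LocallyCompactSpace (A.topPTorsion P) :=
    (hC.isClosed_topPTorsion P).isClosedEmbedding_subtypeVal.locallyCompactSpace
  refine _root_.exists_continuousLinearEquiv_padic p _
    (fun n hn => hsmul n ▸ (hC.smul_bijective_and_isOpenMap hP (hne n hn)).1)
    (fun n hn => hsmul n ▸ (hC.smul_bijective_and_isOpenMap hP (hne n hn)).2)
    (fun U hU => ?_) (fun x U hU => ?_)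
  · obtain ⟨u, hu, huU⟩ := hC.exists_smul_subset_topPTorsion hU
    refine ⟨(u • C).toAddSubgroup.comap (A.topPTorsion P).subtype.toAddMonoidHom,
      (isOpen_smul hu hC.isClopen.isOpen).preimage continuous_subtype_val, huU,
      fun n hn x hx => ?_⟩
    refine hC.mem_smul_of_smul_mem_smul x.2 hu (w := (n : 𝓞 F)) (fun h => hn ((hmem n).1 h)) ?_
    rw [Int.cast_smul_eq_zsmul]
    exact hx
  · obtain ⟨u, hu, huU⟩ := hC.exists_smul_subset_topPTorsion hU
    obtain ⟨N, hN⟩ := hC.mem_topPTorsion_iff.1 x.2 u hu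
    refine ⟨N, huU _ ?_⟩
    have h1 : ((p : ℤ) : 𝓞 F) ∈ P.asIdeal := (hmem p).2 dvd_rfl
    have h2 := hN _ (Ideal.pow_mem_pow h1 N)
    rw [Int.cast_natCast, ← Nat.cast_pow, Nat.cast_smul_eq_nsmul] at h2
    exact h2

end IsAdelicLattice

end PrimaryPart

end LCAMod

theorem mainTheorem10 {F : Type v} [Field F] [NumberField F]
    {S : Set (HeightOneSpectrum (𝓞 F))} (A : LCAMod.{u, v} F S)
    (hvf : A.IsVectorFree) (had : A.IsAdelic) :
    -- (1)
    A.IsTopologicalTorsion ∧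
    -- (2)
    (TotallyDisconnectedSpace A ∧
      TotallyDisconnectedSpace (PontryaginDual (Multiplicative A))) ∧
    -- (3)
    (∀ P ∈ S, IsClosed (A.topPTorsion P : Set A)) ∧
    -- (4) admissible `C` exist, and each of them gives the restricted product decomposition
    ((∃ C : Submodule (𝓞 F) A, LCAMod.IsAdelicLattice S C) ∧
      ∀ C : Submodule (𝓞 F) A, LCAMod.IsAdelicLattice S C →
        (∃ φ : A ≃ₜ+ Πʳ P : S, [A.topPTorsion P, A.topPTorsionInter C P],
          ∀ (α : S.integer F) (a : A) (P : S), φ (α • a) P = α • φ a P) ∧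
        ∀ P ∈ S, LCAMod.IsAdelicLattice S (A.topPTorsionInter C P)) ∧
    -- (5)
    (∀ P ∈ S, ∀ (p : ℕ) [Fact p.Prime],
      P.asIdeal.comap (algebraMap ℤ (𝓞 F)) = Ideal.span {(p : ℤ)} →
        ∃ (_ : Module ℚ_[p] (A.topPTorsion P)) (n : ℕ),
          Nonempty (A.topPTorsion P ≃L[ℚ_[p]] (Fin n → ℚ_[p]))) := by
  obtain ⟨C, hC⟩ := had.exists_isAdelicLattice hvf
  exact ⟨hC.isTopologicalTorsion, ⟨hC.totallyDisconnectedSpace, hC.totallyDisconnectedSpace_dual⟩,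
    fun P _ => hC.isClosed_topPTorsion P,
    ⟨⟨C, hC⟩, fun D hD => ⟨⟨hD.equivTorsionProduct, hD.equivTorsionProduct_smul⟩,
      fun P _ => hD.topPTorsionInter P⟩⟩,
    fun P hP p _ hPp => hC.exists_continuousLinearEquiv_padic hP p hPp⟩
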